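/- Let $N\in\{2,3\}$ and let $\Omega\subset\mathbb R^N$ be a nonempty, open, convex, polygonally/polyhedrally bounded domain (i.e. $\overline\Omega$ is the convex hull of finitely many points). Let $\{\mathcal T_h\}$ be a family of conforming triangulations of $\Omega$ into closed $N$-simplices: each $\mathcal T_h$ is finite, $\overline\Omega=\bigcup_{T\in\mathcal T_h}T$, and two elements are disjoint or meet in a common face. Put $h=\max_{T\in\mathcal T_h}\operatorname{diam}T$ and assume that the family is quasi-uniform: there is $\rho>0$ such that every element of every $\mathcal T_h$ contains a ball of radius $\rho h$. Let $$V_h=\{v\in C(\overline\Omega)\;:\; v|_T \text{ is affine for all } T\in\mathcal T_h,\ v|_{\partial\Omega}=0\}.$$ For $U_\delta\subset\Omega$, a function $w_h\in V_h$ is called discretely harmonic on $U_\delta$ if $\int_\Omega\nabla w_h\cdot\nabla v_h\,dx=0$ for all $v_h\in V_h$ with $v_h=0$ a.e. in $\Omega\setminus U_\delta$. Then there is a constant $C>0$ (independent of $\delta$, $h$, $U$, $U_\delta$ and $w_h$), and for every $\delta>0$ there is $h_\delta>0$ (depending on $\delta$, but not on $U$, $U_\delta$, $h$ and $w_h$),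 such that the following holds. Let $U\subset U_\delta\subset\Omega$ be measurable sets with $\operatorname{dist}(U,\partial U_\delta\setminus\partial\Omega)=\delta$, let $h\le h_\delta$, and let $w_h\in V_h$ be discretely harmonic on $U_\delta$. Then $$\|\nabla w_h\|_{L^2(U)}\le C\,\delta^{-1}\,\|w_h\|_{L^2(U_\delta\setminus U)}.$$ -/

import Mathlib

open MeasureTheory Set Metric
open scoped ENNReal Gradient

/-- `Ω` is an open, convex, polygonally (`N = 2`) or polyhedrally (`N = 3`) bounded domain of `ℝ^N`:
a nonempty open convex set whose closure is the convex hull of finitely many points. -/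
structure IsConvexPolyhedralDomain {N : ℕ} (Ω : Set (EuclideanSpace ℝ (Fin N))) : Prop where
  isOpen : IsOpen Ω
  nonempty : Ω.Nonempty
  convex : Convex ℝ Ω
  polyhedral : ∃ S : Finset (EuclideanSpace ℝ (Fin N)),
    closure Ω = convexHull ℝ (S : Set (EuclideanSpace ℝ (Fin N)))

/-- A conforming (face-to-face) triangulation of `Ω ⊆ ℝ^N`: a finite geometric simplicial complex,
generated by its `N`-dimensional simplices, whose underlying space is the closure of `Ω`.
Simplices are stored through their finite sets of vertices; that two of them meet in a common face
or not at all is part of `Geometry.SimplicialComplex`. -/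
structure Triangulation {N : ℕ} (Ω : Set (EuclideanSpace ℝ (Fin N))) where
  complex : Geometry.SimplicialComplex ℝ (EuclideanSpace ℝ (Fin N))
  finite : complex.faces.Finite
  pure : ∀ s ∈ complex.faces, ∃ t ∈ complex.faces, s ⊆ t ∧ t.card = N + 1
  space_eq : complex.space = closure Ω

namespace Triangulation

variable {N : ℕ} {Ω : Set (EuclideanSpace ℝ (Fin N))}

/-- The vertex sets of the elements (the `N`-dimensional simplices) of the triangulation. The
element itself is the closed simplex `convexHull ℝ s`. -/
def elements (𝒯 : Triangulation Ω) : Set (Finset (EuclideanSpace ℝ (Fin N))) :=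
  {s | s ∈ 𝒯.complex.faces ∧ s.card = N + 1}

/-- The mesh parameter `h`, the largest diameter of an element. -/
noncomputable def meshSize (𝒯 : Triangulation Ω) : ℝ :=
  sSup ((fun s : Finset (EuclideanSpace ℝ (Fin N)) =>
    diam (convexHull ℝ (s : Set (EuclideanSpace ℝ (Fin N))))) '' 𝒯.elements)

/-- The space `V_h` of continuous functions on the closure of `Ω` that are affine on every element
and vanish on the boundary. Functions are total on `ℝ^N`; their values off the closure of `Ω` are
unconstrained and never used. -/
def feSpace (𝒯 : Triangulation Ω) : Submodule ℝ (EuclideanSpace ℝ (Fin N) → ℝ) where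
  carrier := {v | ContinuousOn v (closure Ω) ∧
    (∀ s ∈ 𝒯.elements, ∃ g : EuclideanSpace ℝ (Fin N) →ᵃ[ℝ] ℝ,
      EqOn v g (convexHull ℝ (s : Set (EuclideanSpace ℝ (Fin N))))) ∧
    ∀ x ∈ frontier Ω, v x = 0}
  add_mem' := by
    rintro v w ⟨hv, hv', hv''⟩ ⟨hw, hw', hw''⟩
    refine ⟨hv.add hw, fun s hs => ?_, fun x hx => by simp [hv'' x hx, hw'' x hx]⟩
    obtain ⟨a, ha⟩ := hv' s hs
    obtain ⟨b, hb⟩ := hw' s hs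
    exact ⟨a + b, fun x hx => by simp [ha hx, hb hx]⟩
  zero_mem' := ⟨continuousOn_const, fun _ _ => ⟨0, fun _ _ => rfl⟩, fun _ _ => rfl⟩
  smul_mem' := by
    rintro c v ⟨hv, hv', hv''⟩
    refine ⟨hv.const_smul c, fun s hs => ?_, fun x hx => by simp [hv'' x hx]⟩
    obtain ⟨a, ha⟩ := hv' s hs
    exact ⟨c • a, fun x hx => by simp [ha hx]⟩

/-- `w` is discretely harmonic on `Uδ`: `∫_Ω ∇w · ∇v = 0` for every `v ∈ V_h` that vanishes almost
everywhere in `Ω \ Uδ`. The gradient of a function of `V_h` is the pointwise one, which exists in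
the interior of every element, hence almost everywhere in `Ω`, and is there the weak gradient. -/
def IsDiscretelyHarmonicOn (𝒯 : Triangulation Ω) (w : EuclideanSpace ℝ (Fin N) → ℝ)
    (Uδ : Set (EuclideanSpace ℝ (Fin N))) : Prop :=
  ∀ v ∈ 𝒯.feSpace, (∀ᵐ x ∂(volume.restrict (Ω \ Uδ)), v x = 0) →
    ∫ x in Ω, inner ℝ (∇ w x) (∇ v x) = 0

/-- A family of triangulations is quasi-uniform: every element of every member of the family
contains a ball whose radius is at least a fixed positive multiple of the mesh parameter. -/
def IsQuasiUniform {ι : Type*} (𝒯 : ι → Triangulation Ω) : Prop :=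
  ∃ ρ : ℝ, 0 < ρ ∧ ∀ i, ∀ s ∈ (𝒯 i).elements, ∃ x : EuclideanSpace ℝ (Fin N),
    ball x (ρ * (𝒯 i).meshSize) ⊆ convexHull ℝ (s : Set (EuclideanSpace ℝ (Fin N)))

end Triangulation

/-- The distance `inf {|x - y| : x ∈ A, y ∈ B}` of two sets (infinite if one of them is empty). -/
noncomputable def setEDist {N : ℕ} (A B : Set (EuclideanSpace ℝ (Fin N))) : ℝ≥0∞ :=
  ⨅ x ∈ A, ⨅ y ∈ B, edist x y

/-!
The proof is Caccioppoli's argument, carried out on vertex values. Let `η` be a Lipschitz cutoff of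
slope `3 / δ` that is `1` near `U` and `0` near `∂Uδ \ ∂Ω` (`cutoff`). The points of `Ω` at distance
less than `δ` from `U` lie in `Uδ` (`mem_of_infDist_lt`), so the nodal interpolant `v` of `η² w`
(`Triangulation.exists_interpolant`) is an admissible test function and `∫ ∇w · ∇v = 0`.

On an element `T` all gradients are constant. If `η₀` is the value of `η` at one vertex, then
`v - η₀² w` has the vertex values `(2 η₀ (η - η₀) + (η - η₀)²) w`, where `|η - η₀| ≤ 3 h / δ`. Since `T`
contains a ball of radius `ρ h`, the inverse estimate `norm_affineGradient_mul_le` bounds the gradients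
of `v - η₀² w` and of `w` by vertex values, and Young's inequality gives
`η₀² |∇w|² ≤ 2 ∇w · ∇v + C δ⁻² max |w|²` on `T` (`energy_le_inner_affineGradient`). This takes the place
of superapproximation estimates: only the Lipschitz continuity of `η` is used, no second derivatives.
The last term is absent if `η` is constant on the vertices of `T`.

Summing over the elements, the terms `∇w · ∇v` cancel (`Triangulation.sum_energy_le`). For `h ≤ δ / 6`,
an element that meets `U` has `η = 1` at its vertices, and an element on which `η` is not constant lies,
up to a null set, in `Uδ \ U`. Finally `|T| max |w|²` is at most `4 ^ (N + 1)` times the integral of `w²`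
over `T` (`volume_mul_sq_le_lintegral`), which turns the sum of the error terms into the squared norm
of `w` on `Uδ \ U` (`Triangulation.lintegral_gradient_sq_le`).
-/

/-! ### Affine functions on a simplex -/

section AffineFunctions

variable {F : Type*} [NormedAddCommGroup F] [InnerProductSpace ℝ F]

lemma abs_le_of_mem_convexHull {s : Set F} (g : F →ᵃ[ℝ] ℝ) {M : ℝ} (h : ∀ z ∈ s, |g z| ≤ M)
    {x : F} (hx : x ∈ convexHull ℝ s) : |g x| ≤ M := by
  have hc : Convex ℝ (g ⁻¹' Icc (-M) M) := (convex_Icc (-M) M).affine_preimage g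
  have := convexHull_min (s := s) (fun z hz => abs_le.1 (h z hz)) hc hx
  exact abs_le.2 this

lemma eqOn_convexHull {s : Set F} {g g' : F →ᵃ[ℝ] ℝ} (h : EqOn g g' s) :
    EqOn g g' (convexHull ℝ s) := by
  intro x hx
  have := abs_le_of_mem_convexHull (g - g') (M := 0) (fun z hz => by simp [h hz]) hx
  simpa [sub_eq_zero] using this

/-- A point of the boundary of a convex open set is a convex combination of only those points of the
closure that lie on the boundary themselves, so an affine function vanishing at these vanishes. -/
lemma affine_eq_zero_of_mem_frontier {Ω : Set F} (hΩ : IsOpen Ω) (hconv : Convex ℝ Ω)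
    {s : Finset F} (hs : (s : Set F) ⊆ closure Ω) {g : F →ᵃ[ℝ] ℝ}
    (hg : ∀ z ∈ s, z ∈ frontier Ω → g z = 0) {x : F} (hx : x ∈ convexHull ℝ (s : Set F))
    (hxΩ : x ∈ frontier Ω) : g x = 0 := by
  rw [hΩ.frontier_eq] at hxΩ
  -- the vertices with positive weight lie on a supporting hyperplane at `x`, hence not in `Ω`
  obtain ⟨f, hf⟩ := geometric_hahn_banach_open_point hconv hΩ hxΩ.2
  have hf' : ∀ y ∈ closure Ω, f y ≤ f x :=
    closure_minimal (fun y hy => (hf y hy).le) (isClosed_le f.continuous continuous_const)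
  obtain ⟨w, hw0, hw1, hwx⟩ := Finset.mem_convexHull'.1 hx
  have hsum : ∑ z ∈ s, w z * (f x - f z) = 0 := by
    simp only [mul_sub, Finset.sum_sub_distrib, ← Finset.sum_mul, hw1]
    conv_lhs => rw [← hwx]
    simp [map_sum]
  have hzero := (Finset.sum_eq_zero_iff_of_nonneg fun z hz =>
    mul_nonneg (hw0 z hz) (sub_nonneg.2 (hf' z (hs hz)))).1 hsum
  have hgx : g x = ∑ z ∈ s, w z * g z := by
    have hd : ∀ y, g y = g.linear y + g 0 := fun y => by
      simpa using congrFun (AffineMap.decomp g) y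
    calc g x = ∑ z ∈ s, w z * g.linear z + (∑ z ∈ s, w z) * g 0 := by
          rw [hd x, ← hwx, hw1]; simp [map_sum]
      _ = ∑ z ∈ s, w z * g z := by
          rw [Finset.sum_mul, ← Finset.sum_add_distrib]
          exact Finset.sum_congr rfl fun z _ => by rw [hd z, mul_add]
  rw [hgx]
  refine Finset.sum_eq_zero fun z hz => ?_
  rcases mul_eq_zero.1 (hzero z hz) with h | h
  · rw [h, zero_mul]
  · have hzΩ : z ∉ Ω := fun hzΩ => (hf z hzΩ).ne (sub_eq_zero.1 h).symm
    rw [hg z hz (by rw [hΩ.frontier_eq]; exact ⟨hs hz, hzΩ⟩), mul_zero]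

variable [FiniteDimensional ℝ F]

/-- The constant gradient of an affine function: the vector that represents its linear part. -/
noncomputable def affineGradient (g : F →ᵃ[ℝ] ℝ) : F :=
  (InnerProductSpace.toDual ℝ F).symm (LinearMap.toContinuousLinearMap g.linear)

lemma inner_affineGradient (g : F →ᵃ[ℝ] ℝ) (v : F) :
    inner ℝ (affineGradient g) v = g.linear v := by
  simp [affineGradient]

lemma affineGradient_sub_smul (g g' : F →ᵃ[ℝ] ℝ) (c : ℝ) :
    affineGradient (g - c • g') = affineGradient g - c • affineGradient g' := by
  refine ext_inner_right ℝ fun v => ?_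
  rw [inner_sub_left, inner_smul_left, inner_affineGradient, inner_affineGradient,
    inner_affineGradient]
  simp

lemma gradient_affine (g : F →ᵃ[ℝ] ℝ) (x : F) : ∇ g x = affineGradient g := by
  refine HasGradientAt.gradient ?_
  rw [hasGradientAt_iff_hasFDerivAt]
  have h : (InnerProductSpace.toDual ℝ F) (affineGradient g)
      = LinearMap.toContinuousLinearMap g.linear := by simp [affineGradient]
  rw [h]
  have h1 : (g : F → ℝ) = fun y => LinearMap.toContinuousLinearMap g.linear y + g 0 := by
    funext y
    have := congrFun (AffineMap.decomp g) y
    simpa using this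
  rw [h1]
  exact (ContinuousLinearMap.hasFDerivAt _).add_const _

/-- An inverse estimate: on a simplex containing a ball of radius `r`, the gradient of an affine
function is controlled by `r⁻¹` times its largest vertex value. -/
lemma norm_affineGradient_mul_le {s : Set F} (g : F →ᵃ[ℝ] ℝ) {M r : ℝ} (hr : 0 < r)
    {x : F} (hball : ball x r ⊆ convexHull ℝ s) (h : ∀ z ∈ s, |g z| ≤ M) :
    ‖affineGradient g‖ * r ≤ 2 * M := by
  have hM : |g x| ≤ M := abs_le_of_mem_convexHull g h (hball (mem_ball_self hr))
  have hM0 : 0 ≤ M := (abs_nonneg _).trans hM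
  set a := affineGradient g with ha
  rcases eq_or_ne a 0 with h0 | h0
  · rw [h0]; simpa using hM0
  have hn : 0 < ‖a‖ := norm_pos_iff.2 h0
  refine le_of_forall_lt fun c hc => ?_
  -- move from the centre in the direction of the gradient by any length below the radius
  obtain ⟨t, ht1, ht2⟩ := exists_between (max_lt ((div_lt_iff₀' hn).2 hc) hr)
  have ht0 : 0 < t := (le_max_right _ _).trans_lt ht1
  have hct : c < ‖a‖ * t := (div_lt_iff₀' hn).1 ((le_max_left _ _).trans_lt ht1)
  have hy : x + (t / ‖a‖) • a ∈ ball x r := by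
    rw [mem_ball, dist_eq_norm, add_sub_cancel_left, norm_smul, Real.norm_eq_abs,
      abs_of_pos (by positivity), div_mul_cancel₀ _ hn.ne']
    exact ht2
  have hgy := abs_le_of_mem_convexHull g h (hball hy)
  have heq : g (x + (t / ‖a‖) • a) - g x = ‖a‖ * t := by
    have h1 := g.linearMap_vsub (x + (t / ‖a‖) • a) x
    rw [← inner_affineGradient] at h1
    simp only [vsub_eq_sub, add_sub_cancel_left] at h1
    rw [← h1, inner_smul_right, ← ha, real_inner_self_eq_norm_sq]
    field_simp
  have h1 := abs_le.1 hM
  have h2 := abs_le.1 hgy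
  linarith

/-- On a simplex, the largest vertex value of an affine function is controlled by its mean square:
on the copy of the simplex shrunk by the factor `1/4` towards the vertex where the largest value is
attained, the function stays above half of that value. -/
lemma volume_mul_sq_le_lintegral [MeasurableSpace F] [BorelSpace F] {s : Finset F}
    (μ : Measure F) [μ.IsAddHaarMeasure] (g : F →ᵃ[ℝ] ℝ) {z : F} (hz : z ∈ s)
    (hmax : ∀ y ∈ s, |g y| ≤ |g z|) :
    μ (convexHull ℝ (s : Set F)) * ENNReal.ofReal (|g z| ^ 2) ≤
      ENNReal.ofReal (4 ^ (Module.finrank ℝ F + 1)) *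
        ∫⁻ x in convexHull ℝ (s : Set F), ENNReal.ofReal (|g x| ^ 2) ∂μ := by
  set T := convexHull ℝ (s : Set F) with hT
  have hzT : z ∈ T := subset_convexHull ℝ _ hz
  set T' := AffineMap.homothety z (1 / 4 : ℝ) '' T with hT'
  have hvol : μ T' = ENNReal.ofReal ((1 / 4) ^ Module.finrank ℝ F) * μ T := by
    rw [hT', Measure.addHaar_image_homothety, abs_of_pos (by positivity)]
  have hsub : T' ⊆ T := by
    rintro _ ⟨y, hy, rfl⟩
    rw [AffineMap.homothety_eq_lineMap]
    exact (convex_convexHull ℝ _).lineMap_mem hzT hy ⟨by norm_num, by norm_num⟩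
  have hlow : ∀ x ∈ T', ENNReal.ofReal (|g z| ^ 2 / 4) ≤ ENNReal.ofReal (|g x| ^ 2) := by
    rintro _ ⟨y, hy, rfl⟩
    have hgy : |g y| ≤ |g z| := abs_le_of_mem_convexHull g hmax hy
    have heq : g (AffineMap.homothety z (1 / 4 : ℝ) y) = g z + (1 / 4) * (g y - g z) := by
      rw [AffineMap.homothety_eq_lineMap, AffineMap.apply_lineMap, AffineMap.lineMap_apply]
      simp; ring
    rw [heq]
    refine ENNReal.ofReal_le_ofReal ?_
    have h1 : |g z| / 2 ≤ |g z + (1 / 4) * (g y - g z)| := by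
      have h2 : |g z| ≤ |g z + (1 / 4) * (g y - g z)| + |(1 / 4) * (g y - g z)| := by
        have := abs_sub (g z + (1 / 4) * (g y - g z)) ((1 / 4) * (g y - g z))
        simpa using this
      have h3 : |(1 / 4) * (g y - g z)| ≤ (1 / 4) * (|g y| + |g z|) := by
        rw [abs_mul, abs_of_pos (by norm_num : (0 : ℝ) < 1 / 4)]
        exact mul_le_mul_of_nonneg_left (abs_sub _ _) (by norm_num)
      linarith
    have h4 := pow_le_pow_left₀ (by positivity) h1 2
    linarith [h4, div_pow |g z| 2 2]
  have hcl : IsClosed T' :=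
    ((s.finite_toSet.isCompact_convexHull (𝕜 := ℝ)).image
      (AffineMap.homothety_continuous z (1 / 4 : ℝ))).isClosed
  have hmain : ENNReal.ofReal (|g z| ^ 2 / 4) * μ T' ≤
      ∫⁻ x in T, ENNReal.ofReal (|g x| ^ 2) ∂μ :=
    calc ENNReal.ofReal (|g z| ^ 2 / 4) * μ T'
        = ∫⁻ _ in T', ENNReal.ofReal (|g z| ^ 2 / 4) ∂μ := by rw [setLIntegral_const]
      _ ≤ ∫⁻ x in T', ENNReal.ofReal (|g x| ^ 2) ∂μ :=
          setLIntegral_mono' hcl.measurableSet hlow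
      _ ≤ _ := lintegral_mono_set hsub
  refine le_trans (le_of_eq ?_) (mul_le_mul_right hmain _)
  rw [hvol, ← mul_assoc, ← mul_assoc, ← ENNReal.ofReal_mul (by positivity),
    ← ENNReal.ofReal_mul (by positivity), mul_comm]
  congr 2
  rw [one_div, inv_pow, pow_succ]
  field_simp
  ring

/-- Vertex values on a nondegenerate simplex of full dimension extend to an affine function. -/
lemma exists_affineMap_eqOn {s : Finset F} (hs : AffineIndependent ℝ ((↑) : s → F))
    (hcard : s.card = Module.finrank ℝ F + 1) (u : F → ℝ) : ∃ g : F →ᵃ[ℝ] ℝ, EqOn g u s := by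
  classical
  have htop : affineSpan ℝ (range ((↑) : s → F)) = ⊤ := by
    rw [hs.affineSpan_eq_top_iff_card_eq_finrank_add_one]
    simpa using hcard
  let b : AffineBasis s ℝ F := ⟨(↑), hs, htop⟩
  refine ⟨(∑ z : s, u z • LinearMap.proj (R := ℝ) (φ := fun _ : s => ℝ) z).toAffineMap.comp
    b.coords, fun z hz => ?_⟩
  have hb : b ⟨z, hz⟩ = z := rfl
  have h1 : ∀ i : s, b.coord i z = if i = ⟨z, hz⟩ then 1 else 0 := fun i => by
    conv_lhs => rw [← hb]
    exact b.coord_apply i ⟨z, hz⟩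
  simp [h1]

/-- The faces of dimension less than that of the space are null sets. -/
lemma measure_convexHull_eq_zero [MeasurableSpace F] [BorelSpace F] (μ : Measure F)
    [μ.IsAddHaarMeasure] {s : Finset F} (hs : AffineIndependent ℝ ((↑) : s → F))
    (hcard : s.card ≠ Module.finrank ℝ F + 1) : μ (convexHull ℝ (s : Set F)) = 0 := by
  have htop : affineSpan ℝ (s : Set F) ≠ ⊤ := by
    intro h
    apply hcard
    have h' : affineSpan ℝ (range ((↑) : s → F)) = ⊤ := by simpa using h
    rw [hs.affineSpan_eq_top_iff_card_eq_finrank_add_one] at h'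
    simpa using h'
  exact measure_mono_null (convexHull_subset_affineSpan _) (Measure.addHaar_affineSubspace μ _ htop)

end AffineFunctions

/-! ### Elements of a triangulation -/

namespace Triangulation

variable {N : ℕ} {Ω : Set (EuclideanSpace ℝ (Fin N))}

lemma finite_elements (𝒯 : Triangulation Ω) : 𝒯.elements.Finite :=
  𝒯.finite.subset fun _ hs => hs.1

lemma convexHull_subset_closure (𝒯 : Triangulation Ω) {s : Finset (EuclideanSpace ℝ (Fin N))}
    (hs : s ∈ 𝒯.elements) : convexHull ℝ (s : Set (EuclideanSpace ℝ (Fin N))) ⊆ closure Ω :=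
  𝒯.space_eq ▸ 𝒯.complex.convexHull_subset_space hs.1

lemma exists_mem_elements (𝒯 : Triangulation Ω) {x : EuclideanSpace ℝ (Fin N)}
    (hx : x ∈ closure Ω) :
    ∃ s ∈ 𝒯.elements, x ∈ convexHull ℝ (s : Set (EuclideanSpace ℝ (Fin N))) := by
  rw [← 𝒯.space_eq, Geometry.SimplicialComplex.mem_space_iff] at hx
  obtain ⟨s, hs, hxs⟩ := hx
  obtain ⟨t, ht, hst, hcard⟩ := 𝒯.pure s hs
  exact ⟨t, ⟨ht, hcard⟩, convexHull_mono (Finset.coe_subset.2 hst) hxs⟩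

lemma closure_eq_biUnion (𝒯 : Triangulation Ω) :
    closure Ω = ⋃ s ∈ 𝒯.elements, convexHull ℝ (s : Set (EuclideanSpace ℝ (Fin N))) := by
  refine Subset.antisymm (fun x hx => ?_) (iUnion₂_subset fun s hs => 𝒯.convexHull_subset_closure hs)
  obtain ⟨s, hs, hxs⟩ := 𝒯.exists_mem_elements hx
  exact mem_iUnion₂.2 ⟨s, hs, hxs⟩

lemma isCompact_element (s : Finset (EuclideanSpace ℝ (Fin N))) :
    IsCompact (convexHull ℝ (s : Set (EuclideanSpace ℝ (Fin N)))) :=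
  s.finite_toSet.isCompact_convexHull (𝕜 := ℝ)

lemma dist_le_meshSize (𝒯 : Triangulation Ω) {s : Finset (EuclideanSpace ℝ (Fin N))}
    (hs : s ∈ 𝒯.elements) {x y : EuclideanSpace ℝ (Fin N)}
    (hx : x ∈ convexHull ℝ (s : Set (EuclideanSpace ℝ (Fin N))))
    (hy : y ∈ convexHull ℝ (s : Set (EuclideanSpace ℝ (Fin N)))) : dist x y ≤ 𝒯.meshSize :=
  (dist_le_diam_of_mem (isCompact_element s).isBounded hx hy).trans
    (le_csSup (𝒯.finite_elements.image _).bddAbove (mem_image_of_mem _ hs))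

lemma meshSize_pos (𝒯 : Triangulation Ω) (hN : 0 < N) (hΩ : Ω.Nonempty) : 0 < 𝒯.meshSize := by
  obtain ⟨x, hx⟩ := hΩ
  obtain ⟨s, hs, -⟩ := 𝒯.exists_mem_elements (subset_closure hx)
  obtain ⟨y, hy, z, hz, hyz⟩ := Finset.one_lt_card.1 (by rw [hs.2]; lia : 1 < s.card)
  exact (dist_pos.2 hyz).trans_le (𝒯.dist_le_meshSize hs (subset_convexHull ℝ _ hy)
    (subset_convexHull ℝ _ hz))

/-- Distinct elements overlap in a common face of lower dimension, hence in a null set. -/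
lemma pairwise_aedisjoint (𝒯 : Triangulation Ω) :
    𝒯.elements.Pairwise (Function.onFun (AEDisjoint volume)
      fun s : Finset (EuclideanSpace ℝ (Fin N)) =>
        convexHull ℝ (s : Set (EuclideanSpace ℝ (Fin N)))) := by
  classical
  intro s hs t ht hst
  have hsub : (↑(s ∩ t) : Set (EuclideanSpace ℝ (Fin N))) ⊆ s := by simp
  have h := 𝒯.complex.inter_subset_convexHull hs.1 ht.1
  rw [← Finset.coe_inter] at h
  refine measure_mono_null h (measure_convexHull_eq_zero volume
    ((𝒯.complex.indep hs.1).mono hsub) fun hcard => hst ?_)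
  rw [finrank_euclideanSpace_fin] at hcard
  have h1 : s ∩ t = s :=
    Finset.eq_of_subset_of_card_le Finset.inter_subset_left (by rw [hcard, hs.2])
  have h2 : s ∩ t = t :=
    Finset.eq_of_subset_of_card_le Finset.inter_subset_right (by rw [hcard, ht.2])
  exact h1.symm.trans h2

/-! ### Finite element functions -/

/-- The nodal interpolant: vertex values that vanish on the boundary extend to a function
of `V_h`. -/
lemma exists_interpolant (𝒯 : Triangulation Ω) (hΩ : IsOpen Ω) (hconv : Convex ℝ Ω)
    (u : EuclideanSpace ℝ (Fin N) → ℝ) (hu : ∀ x ∈ frontier Ω, u x = 0) :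
    ∃ v ∈ 𝒯.feSpace, ∀ s ∈ 𝒯.elements, EqOn v u s := by
  classical
  have hex : ∀ s : 𝒯.elements, ∃ g : EuclideanSpace ℝ (Fin N) →ᵃ[ℝ] ℝ, EqOn g u s.1 := fun s =>
    exists_affineMap_eqOn (𝒯.complex.indep s.2.1) (by simpa using s.2.2) u
  choose g hg using hex
  have hel : ∀ x : closure Ω, ∃ s : 𝒯.elements,
      (x : EuclideanSpace ℝ (Fin N)) ∈ convexHull ℝ (s.1 : Set (EuclideanSpace ℝ (Fin N))) :=
    fun x => by
      obtain ⟨s, hs, hx⟩ := 𝒯.exists_mem_elements x.2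
      exact ⟨⟨s, hs⟩, hx⟩
  choose e he using hel
  let v : EuclideanSpace ℝ (Fin N) → ℝ := fun x => if h : x ∈ closure Ω then g (e ⟨x, h⟩) x else 0
  -- two elements meet in the hull of their common vertices, where the local functions agree
  have hv : ∀ s : 𝒯.elements,
      EqOn v (g s) (convexHull ℝ (s.1 : Set (EuclideanSpace ℝ (Fin N)))) := by
    intro s x hx
    have hxΩ : x ∈ closure Ω := 𝒯.convexHull_subset_closure s.2 hx
    simp only [v, dif_pos hxΩ]
    have hmem := 𝒯.complex.inter_subset_convexHull (e ⟨x, hxΩ⟩).2.1 s.2.1 ⟨he ⟨x, hxΩ⟩, hx⟩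
    exact eqOn_convexHull (fun z hz => (hg _ hz.1).trans (hg s hz.2).symm) hmem
  refine ⟨v, ⟨?_, fun s hs => ⟨g ⟨s, hs⟩, hv ⟨s, hs⟩⟩, fun x hx => ?_⟩, fun s hs z hz =>
    (hv ⟨s, hs⟩ (subset_convexHull ℝ _ hz)).trans (hg ⟨s, hs⟩ hz)⟩
  · have : Finite 𝒯.elements := 𝒯.finite_elements
    rw [𝒯.closure_eq_biUnion, biUnion_eq_iUnion]
    exact (locallyFinite_of_finite _).continuousOn_iUnion
      (fun s => (isCompact_element s.1).isClosed)
      fun s => (AffineMap.continuous_of_finiteDimensional (g s)).continuousOn.congr (hv s)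
  · obtain ⟨s, hs, hxs⟩ := 𝒯.exists_mem_elements (frontier_subset_closure hx)
    rw [hv ⟨s, hs⟩ hxs]
    refine affine_eq_zero_of_mem_frontier hΩ hconv ((subset_convexHull ℝ _).trans
      (𝒯.convexHull_subset_closure hs)) (fun z hz hzΩ => ?_) hxs hx
    rw [hg ⟨s, hs⟩ hz, hu z hzΩ]

lemma ae_gradient_eq {v : EuclideanSpace ℝ (Fin N) → ℝ} {g : EuclideanSpace ℝ (Fin N) →ᵃ[ℝ] ℝ}
    {s : Finset (EuclideanSpace ℝ (Fin N))}
    (h : EqOn v g (convexHull ℝ (s : Set (EuclideanSpace ℝ (Fin N))))) :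
    ∀ᵐ x ∂volume.restrict (convexHull ℝ (s : Set (EuclideanSpace ℝ (Fin N)))),
      ∇ v x = affineGradient g := by
  have hfr := (convex_convexHull ℝ (s : Set (EuclideanSpace ℝ (Fin N)))).addHaar_frontier volume
  rw [← Measure.restrict_congr_set (interior_ae_eq_of_null_frontier hfr)]
  refine ae_restrict_of_forall_mem isOpen_interior.measurableSet fun x hx => ?_
  rw [← gradient_affine g x]
  exact (Filter.eventuallyEq_of_mem (mem_interior_iff_mem_nhds.1 hx) h).gradient_eq

/-- The integral over `Ω` of a function that is almost everywhere constant on every element. -/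
lemma integral_eq_sum (𝒯 : Triangulation Ω) (hconv : Convex ℝ Ω)
    {f : EuclideanSpace ℝ (Fin N) → ℝ} {c : Finset (EuclideanSpace ℝ (Fin N)) → ℝ}
    (h : ∀ s ∈ 𝒯.elements, ∀ᵐ x ∂volume.restrict
      (convexHull ℝ (s : Set (EuclideanSpace ℝ (Fin N)))), f x = c s) :
    ∫ x in Ω, f x = ∑ s ∈ 𝒯.finite_elements.toFinset,
      volume.real (convexHull ℝ (s : Set (EuclideanSpace ℝ (Fin N)))) * c s := by
  have : Finite 𝒯.elements := 𝒯.finite_elements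
  have hint : ∀ s ∈ 𝒯.elements, IntegrableOn f
      (convexHull ℝ (s : Set (EuclideanSpace ℝ (Fin N)))) := fun s hs =>
    Integrable.congr (f := fun _ => c s)
      (integrableOn_const (isCompact_element s).measure_lt_top.ne)
      ((h s hs).mono fun x hx => hx.symm)
  have hintU : IntegrableOn f
      (⋃ s : 𝒯.elements, convexHull ℝ (s.1 : Set (EuclideanSpace ℝ (Fin N)))) :=
    integrableOn_finite_iUnion.2 fun s => hint s.1 s.2
  have hval : ∀ s : 𝒯.elements,
      ∫ x in convexHull ℝ (s.1 : Set (EuclideanSpace ℝ (Fin N))), f x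
        = volume.real (convexHull ℝ (s.1 : Set (EuclideanSpace ℝ (Fin N)))) * c s.1 := fun s => by
    rw [integral_congr_ae (h s.1 s.2), setIntegral_const, smul_eq_mul]
  have hsum := integral_iUnion_ae
    (fun s : 𝒯.elements => (isCompact_element s.1).measurableSet.nullMeasurableSet)
    (fun s t hst => 𝒯.pairwise_aedisjoint s.2 t.2 (Subtype.coe_injective.ne hst)) hintU
  rw [← Measure.restrict_congr_set (closure_ae_eq_of_null_frontier (hconv.addHaar_frontier volume)),
    𝒯.closure_eq_biUnion, biUnion_eq_iUnion, hsum, tsum_congr hval]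
  have := Fintype.ofFinite 𝒯.elements
  rw [tsum_fintype]
  exact (Finset.sum_subtype (p := (· ∈ 𝒯.elements)) 𝒯.finite_elements.toFinset
    (fun s => 𝒯.finite_elements.mem_toFinset) fun s =>
      volume.real (convexHull ℝ (s : Set (EuclideanSpace ℝ (Fin N)))) * c s).symm

end Triangulation

/-! ### The local energy estimate -/

/-- Energy estimate on one element, where `v` interpolates `η² w`: replacing `η` by its value `η₀` at
some vertex costs, by the inverse estimate, only the oscillation `L` of `η` relative to the
inradius `r`. -/
lemma energy_le_inner_affineGradient {F : Type*} [NormedAddCommGroup F] [InnerProductSpace ℝ F]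
    [FiniteDimensional ℝ F] {s : Set F} {w v : F →ᵃ[ℝ] ℝ} {η : F → ℝ} {η₀ M L r : ℝ}
    (hr : 0 < r) {x : F} (hball : ball x r ⊆ convexHull ℝ s) (hw : ∀ z ∈ s, |w z| ≤ M)
    (hv : ∀ z ∈ s, v z = η z ^ 2 * w z) (hη₀ : 0 ≤ η₀) (hL : ∀ z ∈ s, |η z - η₀| ≤ L) :
    η₀ ^ 2 * ‖affineGradient w‖ ^ 2 ≤
      2 * inner ℝ (affineGradient w) (affineGradient v) + 24 * (L / r) ^ 2 * M ^ 2 := by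
  have hM0 : 0 ≤ M :=
    (abs_nonneg _).trans (abs_le_of_mem_convexHull w hw (hball (mem_ball_self hr)))
  have ha := norm_affineGradient_mul_le w hr hball hw
  have he : ‖affineGradient (v - η₀ ^ 2 • w)‖ * r ≤ 2 * ((2 * η₀ * L + L ^ 2) * M) := by
    refine norm_affineGradient_mul_le _ hr hball fun z hz => ?_
    have hz' := hL z hz
    have h1 : (v - η₀ ^ 2 • w) z = (2 * η₀ * (η z - η₀) + (η z - η₀) ^ 2) * w z := by
      simp [hv z hz]; ring
    rw [h1, abs_mul]
    refine mul_le_mul ?_ (hw z hz) (abs_nonneg _) ?_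
    · refine (abs_add_le _ _).trans (add_le_add ?_ ?_)
      · rw [abs_mul, abs_of_nonneg (by positivity : 0 ≤ 2 * η₀)]
        exact mul_le_mul_of_nonneg_left hz' (by positivity)
      · rw [abs_pow]
        exact pow_le_pow_left₀ (abs_nonneg _) hz' 2
    · have := (abs_nonneg _).trans hz'
      positivity
  rw [affineGradient_sub_smul] at he
  set a := affineGradient w
  set b := affineGradient v
  set q := L / r
  have hLq : L = q * r := (div_mul_cancel₀ L hr.ne').symm
  rcases s.eq_empty_or_nonempty with rfl | ⟨z, hz⟩
  · exact absurd (hball (mem_ball_self hr)) (by simp)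
  have hL0 : 0 ≤ L := (abs_nonneg _).trans (hL z hz)
  have hq0 : 0 ≤ q := div_nonneg hL0 hr.le
  have hinner : η₀ ^ 2 * ‖a‖ ^ 2 - ‖a‖ * ‖b - η₀ ^ 2 • a‖ ≤ inner ℝ a b := by
    have h1 : inner ℝ a b = inner ℝ a (b - η₀ ^ 2 • a) + η₀ ^ 2 * ‖a‖ ^ 2 := by
      rw [inner_sub_right, inner_smul_right, real_inner_self_eq_norm_sq]; ring
    have h2 := abs_le.1 (abs_real_inner_le_norm a (b - η₀ ^ 2 • a))
    linarith
  have he' : ‖b - η₀ ^ 2 • a‖ ≤ 4 * η₀ * q * M + 2 * q ^ 2 * r * M := by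
    refine le_of_mul_le_mul_right (he.trans (le_of_eq ?_)) hr
    rw [hLq]; ring
  have h3 : ‖a‖ * ‖b - η₀ ^ 2 • a‖ ≤ 4 * (η₀ * ‖a‖) * (q * M) + 4 * (q * M) ^ 2 := by
    calc ‖a‖ * ‖b - η₀ ^ 2 • a‖ ≤ ‖a‖ * (4 * η₀ * q * M + 2 * q ^ 2 * r * M) := by gcongr
      _ = 4 * (η₀ * ‖a‖) * (q * M) + 2 * q ^ 2 * M * (‖a‖ * r) := by ring
      _ ≤ 4 * (η₀ * ‖a‖) * (q * M) + 2 * q ^ 2 * M * (2 * M) := by gcongr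
      _ = _ := by ring
  -- Young's inequality absorbs the mixed term into half of the energy
  have h4 := sq_nonneg (η₀ * ‖a‖ - 4 * (q * M))
  nlinarith

/-! ### Neighbourhoods and the cutoff function -/

/-- The points of `Ω` closer to `U` than `∂Uδ \ ∂Ω` lie in `Uδ`: a segment in `Ω` from a point
of `U` cannot leave `Uδ` without meeting `∂Uδ`. -/
lemma mem_of_infDist_lt {N : ℕ} {Ω U Uδ : Set (EuclideanSpace ℝ (Fin N))} (hΩ : IsOpen Ω)
    (hconv : Convex ℝ Ω) (hU : U.Nonempty) (hUU : U ⊆ Uδ) (hUΩ : Uδ ⊆ Ω) {δ : ℝ}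
    (hδ : ENNReal.ofReal δ ≤ setEDist U (frontier Uδ \ frontier Ω))
    {x : EuclideanSpace ℝ (Fin N)} (hx : x ∈ Ω) (hxU : infDist x U < δ) : x ∈ Uδ := by
  obtain ⟨y, hy, hxy⟩ := (infDist_lt_iff hU).1 hxU
  by_contra hxn
  have hpre : IsPreconnected (segment ℝ y x) := (convex_segment y x).isPreconnected
  obtain ⟨p, hp, hpf⟩ : (segment ℝ y x ∩ frontier Uδ).Nonempty := by
    by_contra hne
    have hn : ∀ p ∈ segment ℝ y x, p ∈ closure Uδ → p ∈ interior Uδ := fun p hp hpc => by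
      by_contra hpi
      exact hne ⟨p, hp, hpc, hpi⟩
    obtain ⟨p, -, hp1, hp2⟩ := hpre (interior Uδ) (closure Uδ)ᶜ isOpen_interior
      isClosed_closure.isOpen_compl
      (fun p hp => (em (p ∈ closure Uδ)).imp (hn p hp) id)
      ⟨y, left_mem_segment ℝ y x, hn y (left_mem_segment ℝ y x) (subset_closure (hUU hy))⟩
      ⟨x, right_mem_segment ℝ y x, fun hc =>
        hxn (interior_subset (hn x (right_mem_segment ℝ y x) hc))⟩
    exact hp2 (subset_closure (interior_subset hp1))
  have hpΩ : p ∈ Ω := hconv.segment_subset (hUΩ (hUU hy)) hx hp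
  have hpn : p ∉ frontier Ω := by
    rw [hΩ.frontier_eq]; exact fun h => h.2 hpΩ
  have h1 : setEDist U (frontier Uδ \ frontier Ω) ≤ edist y p :=
    iInf₂_le_of_le y hy (iInf₂_le_of_le p ⟨hpf, hpn⟩ le_rfl)
  have h2 : dist y p ≤ dist y x := by
    have := dist_add_dist_of_mem_segment hp
    linarith [dist_nonneg (x := p) (y := x)]
  have h3 := hδ.trans h1
  rw [edist_dist, ENNReal.ofReal_le_ofReal_iff dist_nonneg] at h3
  rw [dist_comm] at hxy
  linarith

/-- The cutoff function of slope `3 / δ` that is `1` within distance `δ / 3` of `U` and vanishes at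
distance at least `2δ / 3`. -/
noncomputable def cutoff {α : Type*} [PseudoMetricSpace α] (U : Set α) (δ : ℝ) (x : α) : ℝ :=
  max 0 (min 1 (2 - 3 / δ * infDist x U))

section Cutoff

variable {α : Type*} [PseudoMetricSpace α] {U : Set α} {δ : ℝ} {x y : α}

lemma cutoff_nonneg : 0 ≤ cutoff U δ x := le_max_left _ _

lemma cutoff_eq_one (hδ : 0 < δ) (h : infDist x U ≤ δ / 3) : cutoff U δ x = 1 := by
  have h1 : 3 / δ * infDist x U ≤ 1 := by
    calc 3 / δ * infDist x U ≤ 3 / δ * (δ / 3) := by gcongr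
      _ = 1 := by field_simp
  rw [cutoff, min_eq_left (by linarith), max_eq_right zero_le_one]

lemma cutoff_eq_zero (hδ : 0 < δ) (h : 2 * δ / 3 ≤ infDist x U) : cutoff U δ x = 0 := by
  have h1 : 2 ≤ 3 / δ * infDist x U := by
    calc 2 = 3 / δ * (2 * δ / 3) := by field_simp
      _ ≤ 3 / δ * infDist x U := by gcongr
  exact max_eq_left ((min_le_right _ _).trans (by linarith))

lemma abs_cutoff_sub_le (hδ : 0 < δ) : |cutoff U δ x - cutoff U δ y| ≤ 3 / δ * dist x y := by
  have h1 : |infDist x U - infDist y U| ≤ dist x y := by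
    simpa [Real.dist_eq] using (lipschitz_infDist_pt U).dist_le_mul x y
  calc |cutoff U δ x - cutoff U δ y|
      ≤ |min 1 (2 - 3 / δ * infDist x U) - min 1 (2 - 3 / δ * infDist y U)| := by
        simpa [cutoff] using abs_max_sub_max_le_max 0 (min 1 (2 - 3 / δ * infDist x U)) 0
          (min 1 (2 - 3 / δ * infDist y U))
    _ ≤ |(2 - 3 / δ * infDist x U) - (2 - 3 / δ * infDist y U)| := by
        simpa using abs_min_sub_min_le_max 1 (2 - 3 / δ * infDist x U) 1
          (2 - 3 / δ * infDist y U)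
    _ = 3 / δ * |infDist x U - infDist y U| := by
        rw [sub_sub_sub_cancel_left, ← mul_sub, abs_mul, abs_of_pos (by positivity), abs_sub_comm]
    _ ≤ 3 / δ * dist x y := by gcongr

end Cutoff

/-! ### The Caccioppoli inequality -/

/-- Discrete harmonicity turns the local energy estimates into a global one, in which only elements
where the cutoff `η` is not constant contribute to the right-hand side. -/
lemma Triangulation.sum_energy_le {N : ℕ} {Ω : Set (EuclideanSpace ℝ (Fin N))}
    (𝒯 : Triangulation Ω) (hconv : Convex ℝ Ω)
    {Uδ : Set (EuclideanSpace ℝ (Fin N))} {w v : EuclideanSpace ℝ (Fin N) → ℝ}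
    (hw : 𝒯.IsDiscretelyHarmonicOn w Uδ) (hv : v ∈ 𝒯.feSpace)
    (hv0 : ∀ᵐ x ∂volume.restrict (Ω \ Uδ), v x = 0)
    {η : EuclideanSpace ℝ (Fin N) → ℝ} (hη : ∀ x, 0 ≤ η x)
    (hvw : ∀ s ∈ 𝒯.elements, ∀ z ∈ s, v z = η z ^ 2 * w z)
    {g : Finset (EuclideanSpace ℝ (Fin N)) → (EuclideanSpace ℝ (Fin N) →ᵃ[ℝ] ℝ)}
    (hg : ∀ s ∈ 𝒯.elements,
      EqOn w (g s) (convexHull ℝ (s : Set (EuclideanSpace ℝ (Fin N)))))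
    {m : Finset (EuclideanSpace ℝ (Fin N)) → EuclideanSpace ℝ (Fin N)}
    (hm : ∀ s ∈ 𝒯.elements, m s ∈ s ∧ ∀ z ∈ s, |g s z| ≤ |g s (m s)|)
    {r L : ℝ} (hr : 0 < r)
    (hball : ∀ s ∈ 𝒯.elements, ∃ x : EuclideanSpace ℝ (Fin N),
      ball x r ⊆ convexHull ℝ (s : Set (EuclideanSpace ℝ (Fin N))))
    {B : Finset (Finset (EuclideanSpace ℝ (Fin N)))} (hBsub : B ⊆ 𝒯.finite_elements.toFinset)
    (hL : ∀ s ∈ B, ∀ z ∈ s, |η z - η (m s)| ≤ L)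
    (hconst : ∀ s ∈ 𝒯.elements, s ∉ B → ∀ z ∈ s, η z = η (m s)) :
    ∑ s ∈ 𝒯.finite_elements.toFinset,
        volume.real (convexHull ℝ (s : Set (EuclideanSpace ℝ (Fin N)))) *
          (η (m s) ^ 2 * ‖affineGradient (g s)‖ ^ 2) ≤
      24 * (L / r) ^ 2 * ∑ s ∈ B,
        volume.real (convexHull ℝ (s : Set (EuclideanSpace ℝ (Fin N)))) * |g s (m s)| ^ 2 := by
  classical
  have hex : ∀ s, ∃ k : EuclideanSpace ℝ (Fin N) →ᵃ[ℝ] ℝ, s ∈ 𝒯.elements →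
      EqOn v k (convexHull ℝ (s : Set (EuclideanSpace ℝ (Fin N)))) := fun s => by
    by_cases hs : s ∈ 𝒯.elements
    · obtain ⟨k, hk⟩ := hv.2.1 s hs
      exact ⟨k, fun _ => hk⟩
    · exact ⟨0, fun h => absurd h hs⟩
  choose k hk using hex
  have hzero := hw v hv hv0
  rw [𝒯.integral_eq_sum hconv (c := fun s =>
    inner ℝ (affineGradient (g s)) (affineGradient (k s))) fun s hs => by
      filter_upwards [ae_gradient_eq (hg s hs), ae_gradient_eq (hk s hs)] with x h1 h2
      rw [h1, h2]] at hzero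
  have hloc : ∀ s ∈ 𝒯.finite_elements.toFinset,
      volume.real (convexHull ℝ (s : Set (EuclideanSpace ℝ (Fin N)))) *
          (η (m s) ^ 2 * ‖affineGradient (g s)‖ ^ 2) ≤
        2 * (volume.real (convexHull ℝ (s : Set (EuclideanSpace ℝ (Fin N)))) *
          inner ℝ (affineGradient (g s)) (affineGradient (k s))) +
        if s ∈ B then 24 * (L / r) ^ 2 *
          (volume.real (convexHull ℝ (s : Set (EuclideanSpace ℝ (Fin N)))) * |g s (m s)| ^ 2)
        else 0 := fun s hs => by
    have hs' : s ∈ 𝒯.elements := by simpa using hs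
    obtain ⟨x, hx⟩ := hball s hs'
    have hkz : ∀ z ∈ (s : Set (EuclideanSpace ℝ (Fin N))), k s z = η z ^ 2 * g s z :=
      fun z hz => by
        rw [← hk s hs' (subset_convexHull ℝ _ hz), ← hg s hs' (subset_convexHull ℝ _ hz),
          hvw s hs' z hz]
    have hvol : 0 ≤ volume.real (convexHull ℝ (s : Set (EuclideanSpace ℝ (Fin N)))) :=
      measureReal_nonneg
    split_ifs with hB
    · have h := mul_le_mul_of_nonneg_left (energy_le_inner_affineGradient hr hx (hm s hs').2 hkz
        (hη (m s)) (hL s hB)) hvol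
      linarith
    · have h := mul_le_mul_of_nonneg_left (energy_le_inner_affineGradient (L := 0) hr hx
        (hm s hs').2 hkz (hη (m s)) fun z hz => by simp [hconst s hs' hB z hz]) hvol
      rw [zero_div] at h
      linarith
  refine (Finset.sum_le_sum hloc).trans (le_of_eq ?_)
  rw [Finset.sum_add_distrib, ← Finset.mul_sum, hzero, mul_zero, zero_add, ← Finset.sum_filter,
    Finset.filter_mem_eq_inter, Finset.inter_eq_right.2 hBsub, Finset.mul_sum]

/-- From element sums to norms: the weights `κ` are `1` on the elements that meet `U`, so the energy on
`U` is at most the weighted sum; the elements of `B` lie in `A` up to a null set, so the sum of their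
vertex values is controlled by the mean square on `A`. -/
lemma Triangulation.lintegral_gradient_sq_le {N : ℕ} {Ω : Set (EuclideanSpace ℝ (Fin N))}
    (𝒯 : Triangulation Ω) (hconv : Convex ℝ Ω) {U A : Set (EuclideanSpace ℝ (Fin N))}
    (hUΩ : U ⊆ Ω) {w : EuclideanSpace ℝ (Fin N) → ℝ}
    {g : Finset (EuclideanSpace ℝ (Fin N)) → (EuclideanSpace ℝ (Fin N) →ᵃ[ℝ] ℝ)}
    (hg : ∀ s ∈ 𝒯.elements,
      EqOn w (g s) (convexHull ℝ (s : Set (EuclideanSpace ℝ (Fin N)))))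
    {m : Finset (EuclideanSpace ℝ (Fin N)) → EuclideanSpace ℝ (Fin N)}
    (hm : ∀ s ∈ 𝒯.elements, m s ∈ s ∧ ∀ z ∈ s, |g s z| ≤ |g s (m s)|)
    {κ : Finset (EuclideanSpace ℝ (Fin N)) → ℝ}
    (hκU : ∀ s ∈ 𝒯.elements,
      (U ∩ convexHull ℝ (s : Set (EuclideanSpace ℝ (Fin N)))).Nonempty → κ s = 1)
    {B : Finset (Finset (EuclideanSpace ℝ (Fin N)))} (hBsub : B ⊆ 𝒯.finite_elements.toFinset)
    (hBA : ∀ s ∈ B, convexHull ℝ (s : Set (EuclideanSpace ℝ (Fin N))) ∩ Ω ⊆ A) {K : ℝ} (hK : 0 ≤ K)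
    (hsum : ∑ s ∈ 𝒯.finite_elements.toFinset,
        volume.real (convexHull ℝ (s : Set (EuclideanSpace ℝ (Fin N)))) *
          (κ s ^ 2 * ‖affineGradient (g s)‖ ^ 2) ≤
      K * ∑ s ∈ B,
        volume.real (convexHull ℝ (s : Set (EuclideanSpace ℝ (Fin N)))) * |g s (m s)| ^ 2) :
    ∫⁻ x in U, ‖∇ w x‖ₑ ^ 2 ≤ ENNReal.ofReal (K * 4 ^ (N + 1)) * ∫⁻ x in A, ‖w x‖ₑ ^ 2 := by
  have hfin : ∀ s : Finset (EuclideanSpace ℝ (Fin N)),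
      volume (convexHull ℝ (s : Set (EuclideanSpace ℝ (Fin N)))) ≠ ∞ := fun s =>
    (isCompact_element s).measure_lt_top.ne
  have hlhs : ∫⁻ x in U, ‖∇ w x‖ₑ ^ 2 ≤ ENNReal.ofReal (∑ s ∈ 𝒯.finite_elements.toFinset,
      volume.real (convexHull ℝ (s : Set (EuclideanSpace ℝ (Fin N)))) *
        (κ s ^ 2 * ‖affineGradient (g s)‖ ^ 2)) := by
    have hcover : U ⊆ ⋃ s : 𝒯.finite_elements.toFinset,
        U ∩ convexHull ℝ (s.1 : Set (EuclideanSpace ℝ (Fin N))) := fun x hx => by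
      obtain ⟨s, hs, hxs⟩ := 𝒯.exists_mem_elements (subset_closure (hUΩ hx))
      exact mem_iUnion.2 ⟨⟨s, by simpa using hs⟩, hx, hxs⟩
    rw [ENNReal.ofReal_sum_of_nonneg fun s _ => by positivity, ← Finset.sum_coe_sort,
      ← tsum_fintype (L := SummationFilter.unconditional _)]
    refine (lintegral_mono_set hcover).trans ((lintegral_iUnion_le _ _).trans
      (ENNReal.tsum_le_tsum fun s => ?_))
    have hs : s.1 ∈ 𝒯.elements := 𝒯.finite_elements.mem_toFinset.1 s.2
    rcases (U ∩ convexHull ℝ (s.1 : Set (EuclideanSpace ℝ (Fin N)))).eq_empty_or_nonempty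
      with hne | hne
    · rw [hne]; simp
    · refine (lintegral_mono_set inter_subset_right).trans (le_of_eq ?_)
      rw [lintegral_congr_ae ((ae_gradient_eq (hg s.1 hs)).mono fun x hx => by rw [hx]),
        setLIntegral_const, hκU s.1 hs hne, one_pow, one_mul,
        ENNReal.ofReal_mul measureReal_nonneg, ofReal_measureReal (hfin s.1), mul_comm,
        ENNReal.ofReal_pow (norm_nonneg _), ofReal_norm]
  have hrhs : ENNReal.ofReal (∑ s ∈ B,
      volume.real (convexHull ℝ (s : Set (EuclideanSpace ℝ (Fin N)))) * |g s (m s)| ^ 2) ≤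
      ENNReal.ofReal (4 ^ (N + 1)) * ∫⁻ x in A, ‖w x‖ₑ ^ 2 := by
    have hBel : ∀ s ∈ B, s ∈ 𝒯.elements := fun s hs => by simpa using hBsub hs
    rw [ENNReal.ofReal_sum_of_nonneg fun s _ => by positivity]
    calc ∑ s ∈ B, ENNReal.ofReal
          (volume.real (convexHull ℝ (s : Set (EuclideanSpace ℝ (Fin N)))) * |g s (m s)| ^ 2)
        ≤ ∑ s ∈ B, ENNReal.ofReal (4 ^ (N + 1)) *
          ∫⁻ x in convexHull ℝ (s : Set (EuclideanSpace ℝ (Fin N))), ‖w x‖ₑ ^ 2 := by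
          refine Finset.sum_le_sum fun s hs => ?_
          have hs' := hBel s hs
          rw [ENNReal.ofReal_mul measureReal_nonneg, ofReal_measureReal (hfin s)]
          refine (volume_mul_sq_le_lintegral volume (g s) (hm s hs').1 (hm s hs').2).trans
            (le_of_eq ?_)
          rw [finrank_euclideanSpace_fin]
          congr 1
          refine setLIntegral_congr_fun (isCompact_element s).measurableSet fun x hx => ?_
          simp only [hg s hs' hx]
          rw [ENNReal.ofReal_pow (abs_nonneg _), ← Real.norm_eq_abs, ofReal_norm]
      _ = ENNReal.ofReal (4 ^ (N + 1)) * ∫⁻ x in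
          ⋃ s ∈ B, convexHull ℝ (s : Set (EuclideanSpace ℝ (Fin N))), ‖w x‖ₑ ^ 2 := by
          rw [← Finset.mul_sum, lintegral_biUnion_finset₀
            (fun s hs t ht hst => 𝒯.pairwise_aedisjoint (hBel s hs) (hBel t ht) hst)
            fun s _ => (isCompact_element s).measurableSet.nullMeasurableSet]
      _ ≤ ENNReal.ofReal (4 ^ (N + 1)) * ∫⁻ x in A, ‖w x‖ₑ ^ 2 := by
          refine mul_le_mul_right (lintegral_mono' (Measure.restrict_mono_ae ?_) le_rfl) _
          -- the elements of `B` lie in the closure of `Ω`, which exceeds `Ω` by a null set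
          filter_upwards [(closure_ae_eq_of_null_frontier (hconv.addHaar_frontier volume)).mem_iff]
            with x hx hxB
          obtain ⟨s, hs, hxs⟩ := mem_iUnion₂.1 hxB
          exact hBA s hs ⟨hxs, hx.1 (𝒯.convexHull_subset_closure (hBel s hs) hxs)⟩
  calc ∫⁻ x in U, ‖∇ w x‖ₑ ^ 2 ≤ _ := hlhs
    _ ≤ ENNReal.ofReal (K * ∑ s ∈ B,
        volume.real (convexHull ℝ (s : Set (EuclideanSpace ℝ (Fin N)))) * |g s (m s)| ^ 2) :=
        ENNReal.ofReal_le_ofReal hsum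
    _ ≤ ENNReal.ofReal K * (ENNReal.ofReal (4 ^ (N + 1)) * ∫⁻ x in A, ‖w x‖ₑ ^ 2) := by
        rw [ENNReal.ofReal_mul hK]; exact mul_le_mul_right hrhs _
    _ = _ := by rw [← mul_assoc, ← ENNReal.ofReal_mul hK]

lemma eLpNorm_two_sq {α G : Type*} [MeasurableSpace α] [NormedAddCommGroup G] (f : α → G)
    (μ : Measure α) : eLpNorm f 2 μ ^ 2 = ∫⁻ x, ‖f x‖ₑ ^ 2 ∂μ := by
  have h := eLpNorm_nnreal_pow_eq_lintegral (f := f) (μ := μ) (p := 2) two_ne_zero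
  simpa using h

theorem mainTheorem5 {N : ℕ} (hN : N = 2 ∨ N = 3) (Ω : Set (EuclideanSpace ℝ (Fin N)))
    (hΩ : IsConvexPolyhedralDomain Ω) {ι : Type*} (𝒯 : ι → Triangulation Ω)
    (h𝒯 : Triangulation.IsQuasiUniform 𝒯) :
    ∃ C : ℝ, 0 < C ∧ ∀ δ : ℝ, 0 < δ → ∃ hδ : ℝ, 0 < hδ ∧
      ∀ U Uδ : Set (EuclideanSpace ℝ (Fin N)), MeasurableSet U → MeasurableSet Uδ →
        U ⊆ Uδ → Uδ ⊆ Ω → setEDist U (frontier Uδ \ frontier Ω) = ENNReal.ofReal δ →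
        ∀ i : ι, (𝒯 i).meshSize ≤ hδ →
          ∀ w ∈ (𝒯 i).feSpace, (𝒯 i).IsDiscretelyHarmonicOn w Uδ →
            eLpNorm (∇ w) 2 (volume.restrict U) ≤
              ENNReal.ofReal (C * δ⁻¹) * eLpNorm w 2 (volume.restrict (Uδ \ U)) := by
  classical
  obtain ⟨ρ, hρ, hball⟩ := h𝒯
  -- `24 (3 / ρ)²` comes from the energy estimate with a cutoff of slope `3 / δ`, and `4 ^ (N + 1)`
  -- from the passage from vertex values to mean squares; both enter under a square root
  refine ⟨√(24 * (3 / ρ) ^ 2 * 4 ^ (N + 1)), by positivity, fun δ hδ => ⟨δ / 6, by positivity,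
    fun U Uδ hU hUδ hUU hUΩ hdist i hi w hw hharm => ?_⟩⟩
  set h := (𝒯 i).meshSize
  have hpos : 0 < h := (𝒯 i).meshSize_pos (by lia) hΩ.nonempty
  have hUne : U.Nonempty := by
    by_contra hne
    rw [not_nonempty_iff_eq_empty] at hne
    simp [setEDist, hne] at hdist
  have hnear : ∀ x ∈ Ω, infDist x U < δ → x ∈ Uδ := fun x hx hxU =>
    mem_of_infDist_lt hΩ.isOpen hΩ.convex hUne hUU hUΩ hdist.ge hx hxU
  -- points of one element have almost the same distance to `U`
  have hclose : ∀ s ∈ (𝒯 i).elements,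
      ∀ x ∈ convexHull ℝ (s : Set (EuclideanSpace ℝ (Fin N))),
      ∀ y ∈ convexHull ℝ (s : Set (EuclideanSpace ℝ (Fin N))),
        infDist x U ≤ infDist y U + δ / 6 := fun s hs x hx y hy =>
    infDist_le_infDist_add_dist.trans
      (add_le_add_right (((𝒯 i).dist_le_meshSize hs hx hy).trans hi) _)
  set η := cutoff U δ
  obtain ⟨v, hv, hvw⟩ := (𝒯 i).exists_interpolant hΩ.isOpen hΩ.convex (fun x => η x ^ 2 * w x)
    fun x hx => by rw [hw.2.2 x hx, mul_zero]
  have hex : ∀ s, ∃ (g : EuclideanSpace ℝ (Fin N) →ᵃ[ℝ] ℝ) (z : EuclideanSpace ℝ (Fin N)),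
      s ∈ (𝒯 i).elements → EqOn w g (convexHull ℝ (s : Set (EuclideanSpace ℝ (Fin N)))) ∧
        z ∈ s ∧ ∀ y ∈ s, |g y| ≤ |g z| := fun s => by
    by_cases hs : s ∈ (𝒯 i).elements
    · obtain ⟨g, hg⟩ := hw.2.1 s hs
      obtain ⟨z, hz, hmax⟩ := s.exists_max_image (fun y => |g y|)
        (Finset.card_pos.1 (by rw [hs.2]; lia))
      exact ⟨g, z, fun _ => ⟨hg, hz, hmax⟩⟩
    · exact ⟨0, 0, fun hs' => absurd hs' hs⟩
  choose g m hgm using hex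
  have hv0 : ∀ᵐ x ∂volume.restrict (Ω \ Uδ), v x = 0 := by
    refine ae_restrict_of_forall_mem (hΩ.isOpen.measurableSet.diff hUδ) fun x hx => ?_
    obtain ⟨s, hs, hxs⟩ := (𝒯 i).exists_mem_elements (subset_closure hx.1)
    obtain ⟨k, hk⟩ := hv.2.1 s hs
    have hfar : δ ≤ infDist x U := not_lt.1 fun hlt => hx.2 (hnear x hx.1 hlt)
    rw [hk hxs]
    have := abs_le_of_mem_convexHull k (M := 0) (fun z hz => ?_) hxs
    · simpa using this
    · have hzs := subset_convexHull ℝ (s : Set (EuclideanSpace ℝ (Fin N))) hz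
      have hηz : η z = 0 := cutoff_eq_zero hδ (by linarith [hclose s hs x hxs z hzs])
      rw [← hk hzs, hvw s hs hz]
      simp [hηz]
  set B := (𝒯 i).finite_elements.toFinset.filter fun s => ∃ z ∈ s, η z ≠ η (m s) with hB
  have hBmem : ∀ s ∈ B, s ∈ (𝒯 i).elements ∧ ∃ z ∈ s, η z ≠ η (m s) := fun s hs => by
    simpa [hB] using hs
  have hsum := (𝒯 i).sum_energy_le hΩ.convex (L := 3 / δ * h) hharm hv hv0
    (η := η) (fun _ => cutoff_nonneg) (fun s hs z hz => hvw s hs hz) (fun s hs => (hgm s hs).1)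
    (fun s hs => (hgm s hs).2) (mul_pos hρ hpos) (hball i) (B := B) (Finset.filter_subset _ _)
    (fun s hs z hz => (abs_cutoff_sub_le hδ).trans (mul_le_mul_of_nonneg_left
      ((𝒯 i).dist_le_meshSize (hBmem s hs).1 (subset_convexHull ℝ _ hz)
        (subset_convexHull ℝ _ (hgm s (hBmem s hs).1).2.1)) (by positivity)))
    (fun s hs hsB z hz => by
      by_contra hne
      exact hsB (by simpa [hB] using ⟨hs, z, hz, hne⟩))
  have hone : ∀ s ∈ (𝒯 i).elements,
      (U ∩ convexHull ℝ (s : Set (EuclideanSpace ℝ (Fin N)))).Nonempty →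
        ∀ z ∈ s, η z = 1 := fun s hs ⟨x, hxU, hxs⟩ z hz =>
    cutoff_eq_one hδ (by
      have := hclose s hs z (subset_convexHull ℝ _ hz) x hxs
      rw [infDist_zero_of_mem hxU] at this
      linarith)
  have hBA : ∀ s ∈ B, convexHull ℝ (s : Set (EuclideanSpace ℝ (Fin N))) ∩ Ω ⊆ Uδ \ U := by
    rintro s hsB x ⟨hxs, hxΩ⟩
    obtain ⟨hs, z, hz, hne⟩ := hBmem s hsB
    have hms := (hgm s hs).2.1
    refine ⟨hnear x hxΩ (not_le.1 fun hle => hne ?_), fun hxU => hne ?_⟩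
    · have hzero : ∀ y ∈ s, η y = 0 := fun y hy =>
        cutoff_eq_zero hδ (by linarith [hclose s hs x hxs y (subset_convexHull ℝ _ hy)])
      rw [hzero z hz, hzero _ hms]
    · rw [hone s hs ⟨x, hxU, hxs⟩ z hz, hone s hs ⟨x, hxU, hxs⟩ _ hms]
  have hmain := (𝒯 i).lintegral_gradient_sq_le hΩ.convex (hUU.trans hUΩ)
    (fun s hs => (hgm s hs).1) (fun s hs => (hgm s hs).2)
    (fun s hs hne => hone s hs hne _ (hgm s hs).2.1) (Finset.filter_subset _ _) hBA
    (by positivity) hsum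
  rw [← eLpNorm_two_sq, ← eLpNorm_two_sq] at hmain
  have hC : 24 * (3 / δ * h / (ρ * h)) ^ 2 * 4 ^ (N + 1)
      = (√(24 * (3 / ρ) ^ 2 * 4 ^ (N + 1)) * δ⁻¹) ^ 2 := by
    rw [mul_pow, Real.sq_sqrt (by positivity)]
    field_simp
  rw [hC, ENNReal.ofReal_pow (by positivity), ← mul_pow] at hmain
  exact (ENNReal.pow_le_pow_left_iff two_ne_zero).1 hmain
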